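/- Let $d\ge 1$. For $N\ge 2$ even let $[N]^d=\{1,\dots,N\}^d$, write $i\sim j$ if $\sum_k|i_k-j_k|=1$, let $\partial[N]^d=\{i\in[N]^d:\ i_k\in\{1,N\}\text{ for some }k\}$ and $c_d(N)=(N/2,\dots,N/2)$. Consider the network of harmonic oscillators on $[N]^d$ with equal masses $m>0$, unit couplings, pinning strengths $\eta_i>0$ $(i\in[N]^d)$ and friction of strength $\gamma_i>0$ at the particles $i$ of a non-empty set $I\subseteq\partial[N]^d$. Put $$B=-\Delta+\operatorname{diag}(\eta_i),\qquad \langle u,-\Delta u\rangle=\sum_{\{i,j\}:\, i\sim j}(u_i-u_j)^2,\qquad \Gamma=\operatorname{diag}(\gamma_i\,1_{i\in I}),$$ $$\Omega=\begin{pmatrix}\Gamma&-m^{-1/2}B^{1/2}\\ B^{1/2}m^{-1/2}&0\end{pmatrix}.$$ The generator of the dynamics is $\mathcal L=-z\,\Omega\cdot\nabla_z+\nabla_p\cdot\Gamma\Theta\nabla_p$, with $\Theta$ the diagonal matrix of bath temperatures, and its spectral gap is $$\lambda_S=\inf\{\operatorname{Re}\lambda:\ \lambda\in\operatorname{Spec}(\Omega)\}.$$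 Let $m>0$, $\varepsilon>0$ and $g$ be fixed. Then there are constants $C,c>0$, depending only on $d,m,\varepsilon,g$, such that for every even $N\ge 2$ and all $\eta$, $I$, $\gamma$ as above with $$\gamma_i\le g\quad(i\in I),\qquad \eta_{c_d(N)}+2d+\varepsilon\le\eta_i\quad (i\in[N]^d,\ i\ne c_d(N)),$$ one has $$0\le\lambda_S\le C e^{-cN}.$$ -/

import Mathlib

/-- The box `[N]^d = {1, …, N}^d`, the sites of the network. -/
abbrev Site (d N : ℕ) : Type := Fin d → Finset.Icc 1 N

/-- Nearest-neighbour graph on `[N]^d ⊂ ℤ^d`: two sites are adjacent when their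
`ℓ¹`-distance is `1`. -/
def latticeGraph (d N : ℕ) : SimpleGraph (Site d N) where
  Adj i j := ∑ k, |((i k : ℕ) : ℤ) - ((j k : ℕ) : ℤ)| = 1
  symm := ⟨fun i j h => by simpa only [abs_sub_comm] using h⟩
  loopless := ⟨fun i h => by simp at h⟩

instance (d N : ℕ) : DecidableRel (latticeGraph d N).Adj :=
  fun i j => inferInstanceAs (Decidable (∑ k, |((i k : ℕ) : ℤ) - ((j k : ℕ) : ℤ)| = 1))

/-- The boundary `∂[N]^d`: some coordinate equals `1` or `N`. -/
def boundary (d N : ℕ) : Set (Site d N) :=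
  {i | ∃ k, (i k : ℕ) = 1 ∨ (i k : ℕ) = N}

/-- The centre point `c_d(N) = (N/2, …, N/2)`. -/
def centre (d N : ℕ) (hN : 2 ≤ N) : Site d N :=
  fun _ => ⟨N / 2, Finset.mem_Icc.2 ⟨by omega, by omega⟩⟩

/-- The discrete Schrödinger operator `B = -Δ + ∑ η_i δ_i` with unit couplings, where `-Δ` is the
negative Neumann Laplacian of the box, i.e. `⟨u, -Δ u⟩ = ∑_{i ∼ j} (u i - u j)²`, the sum running
over unordered pairs of nearest neighbours. -/
def schrodinger (d N : ℕ) (η : Site d N → ℝ) : Matrix (Site d N) (Site d N) ℝ :=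
  (latticeGraph d N).lapMatrix ℝ + Matrix.diagonal η

/-- The friction matrix `Γ = diag(γ_i δ_{i ∈ I})`. -/
def frictionMatrix {d N : ℕ} (I : Finset (Site d N)) (γ : Site d N → ℝ) :
    Matrix (Site d N) (Site d N) ℝ :=
  Matrix.diagonal fun i => if i ∈ I then γ i else 0

open scoped MatrixOrder in
/-- The drift matrix `Ω = [[Γ, -m^{-1/2} B^{1/2}], [B^{1/2} m^{-1/2}, 0]]` of the generator
`-z Ω · ∇_z + ∇_p · Γ Θ ∇_p`, all masses being equal to `m`. Here `CFC.sqrt` is the positive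
semidefinite square root of a positive semidefinite matrix. -/
noncomputable def driftMatrix {d N : ℕ} (m : ℝ) (η : Site d N → ℝ) (I : Finset (Site d N))
    (γ : Site d N → ℝ) : Matrix (Site d N ⊕ Site d N) (Site d N ⊕ Site d N) ℝ :=
  Matrix.fromBlocks
    (frictionMatrix I γ) (-((√m)⁻¹ • CFC.sqrt (schrodinger d N η)))
    ((√m)⁻¹ • CFC.sqrt (schrodinger d N η)) 0

/-- The spectral gap `λ_S = inf {Re λ : λ ∈ Spec Ω}` of the generator. -/
noncomputable def spectralGap {d N : ℕ} (m : ℝ) (η : Site d N → ℝ) (I : Finset (Site d N))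
    (γ : Site d N → ℝ) : ℝ :=
  sInf (Complex.re '' spectrum ℂ ((driftMatrix m η I γ).map (algebraMap ℝ ℂ)))

/-! The pinning is lowest at the centre `c`, so `B` has an eigenvalue `E ≤ B c c ≤ η c + 2d`. All
other sites have `η i ≥ E + ε`, which forces the eigenvector `ψ` to decay geometrically towards the
boundary. The normal mode `Z = (ψ, -iψ)` of the skew part of `Ω` is therefore hardly damped: `⟨Z,
ΓZ⟩ ≤ δ‖Z‖²` with `δ` exponentially small.

Because `Ω` is not normal, a small quadratic form alone does not give a nearby eigenvalue.
`Matrix.exists_mem_spectrum_re_le` supplies one using traces. With `n` the size of the matrix, the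
resolvent `R` at distance `δ` to the left of `iω` satisfies `R + R* ≥ 0`, so `Re ⟨Z, RZ⟩ ≤ Re tr R ·
‖Z‖²`. Weak damping makes the left side at least `‖Z‖²/(2δ)`, while a spectrum far to the right
makes `tr R` small. The loss is only a factor of order `n`, polynomial in `N`. -/

/-! ### Spectra of dissipative perturbations of skew-Hermitian matrices -/

open scoped ComplexOrder MatrixOrder in
/-- The quadratic form of a positive semidefinite matrix is bounded by its trace. -/
theorem Matrix.PosSemidef.re_dotProduct_mulVec_le_trace {ι : Type*} [Fintype ι]
    {H : Matrix ι ι ℂ} (hH : H.PosSemidef) (v : ι → ℂ) :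
    (star v ⬝ᵥ H.mulVec v).re ≤ H.trace.re * (star v ⬝ᵥ v).re := by
  classical
  -- For `H = B* B` the trace is the squared Hilbert–Schmidt norm of `B`, and Cauchy–Schwarz in each
  -- row suffices.
  obtain ⟨B, rfl⟩ := CStarAlgebra.nonneg_iff_eq_star_mul_self.mp hH.nonneg
  rw [Matrix.star_eq_conjTranspose]
  have key : ∀ w : ι → ℂ, (star w ⬝ᵥ w).re = ∑ i, ‖w i‖ ^ 2 := fun w => by
    simp [dotProduct, Complex.sq_norm, Complex.normSq_apply]
  have h1 : star v ⬝ᵥ (B.conjTranspose * B).mulVec v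
      = star (B.mulVec v) ⬝ᵥ B.mulVec v := by
    rw [← Matrix.mulVec_mulVec, Matrix.dotProduct_mulVec, Matrix.star_mulVec]
  have h2 : ((B.conjTranspose * B).trace).re = ∑ i, ∑ j, ‖B i j‖ ^ 2 := by
    rw [Finset.sum_comm]
    simp [Matrix.trace, Matrix.mul_apply, Complex.sq_norm, Complex.normSq_apply]
  rw [h1, key, key, h2, Finset.sum_mul]
  refine Finset.sum_le_sum fun i _ => ?_
  calc ‖B.mulVec v i‖ ^ 2 ≤ (∑ j, ‖B i j‖ * ‖v j‖) ^ 2 := by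
        gcongr
        simpa only [Matrix.mulVec, dotProduct, norm_mul] using
          norm_sum_le Finset.univ fun j => B i j * v j
    _ ≤ _ := Finset.sum_mul_sq_le_sq_mul_sq _ _ _

/-- The trace of a complex matrix is bounded by its size times its spectral radius. -/
theorem Matrix.norm_trace_le_card_mul {ι : Type*} [Fintype ι] [DecidableEq ι]
    (R : Matrix ι ι ℂ) {b : ℝ} (hb : ∀ ρ ∈ spectrum ℂ R, ‖ρ‖ ≤ b) :
    ‖R.trace‖ ≤ Fintype.card ι * b := by
  rw [Matrix.trace_eq_sum_roots_charpoly]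
  have hcard : R.charpoly.roots.card = Fintype.card ι := by
    rw [IsAlgClosed.card_roots_eq_natDegree, Matrix.charpoly_natDegree_eq_dim]
  have h := norm_multiset_sum_le R.charpoly.roots
  refine h.trans ?_
  have h2 := Multiset.sum_le_card_nsmul (R.charpoly.roots.map fun x => ‖x‖) b (by
    intro x hx
    obtain ⟨ρ, hρ, rfl⟩ := Multiset.mem_map.1 hx
    exact hb ρ (Matrix.mem_spectrum_of_isRoot_charpoly
      ((Polynomial.mem_roots (R.charpoly_monic.ne_zero)).1 hρ)))
  simpa [hcard] using h2

theorem Matrix.star_dotProduct_mulVec_eq_star {ι : Type*} [Fintype ι] (M : Matrix ι ι ℂ)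
    (u v : ι → ℂ) : star u ⬝ᵥ M.mulVec v = star (star v ⬝ᵥ M.conjTranspose.mulVec u) := by
  rw [Matrix.star_dotProduct, Matrix.star_mulVec, ← Matrix.dotProduct_mulVec]

/-- The quadratic form of a skew-Hermitian matrix is purely imaginary. -/
theorem Matrix.re_dotProduct_mulVec_eq_zero {ι : Type*} [Fintype ι] {K : Matrix ι ι ℂ}
    (hK : K.conjTranspose = -K) (v : ι → ℂ) : (star v ⬝ᵥ K.mulVec v).re = 0 := by
  have h := congrArg Complex.re (Matrix.star_dotProduct_mulVec_eq_star K v v)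
  rw [hK, Matrix.neg_mulVec, dotProduct_neg] at h
  simp only [star_neg, Complex.neg_re, RCLike.star_def, Complex.conj_re] at h
  linarith

open scoped ComplexOrder in
/-- The spectrum of a dissipative perturbation of a skew-Hermitian matrix lies in the closed right
half-plane. -/
theorem Matrix.re_nonneg_of_mem_spectrum {ι : Type*} [Fintype ι] [DecidableEq ι]
    {G K : Matrix ι ι ℂ} (hG : G.PosSemidef) (hK : K.conjTranspose = -K) {l : ℂ}
    (hl : l ∈ spectrum ℂ (G + K)) : 0 ≤ l.re := by
  rw [spectrum.mem_iff, Matrix.isUnit_iff_isUnit_det, isUnit_iff_ne_zero, not_not,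
    ← Matrix.exists_mulVec_eq_zero_iff] at hl
  obtain ⟨v, hv, h⟩ := hl
  rw [Matrix.sub_mulVec, Matrix.add_mulVec, Algebra.algebraMap_eq_smul_one, Matrix.smul_mulVec,
    Matrix.one_mulVec, sub_eq_zero] at h
  have h1 := congrArg (fun w => (star v ⬝ᵥ w).re) h
  have hpos := Complex.lt_def.1 (dotProduct_star_self_pos_iff.2 hv)
  simp only [dotProduct_smul, dotProduct_add, Complex.add_re, smul_eq_mul, Complex.mul_re,
    re_dotProduct_mulVec_eq_zero hK, ← hpos.2, Complex.zero_im, mul_zero, sub_zero, add_zero] at h1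
  exact nonneg_of_mul_nonneg_left (h1 ▸ hG.re_dotProduct_nonneg v) hpos.1

open scoped ComplexOrder in
/-- A dissipative perturbation of a skew-Hermitian matrix, with damping at most `δ` on one
eigenvector of the skew-Hermitian part, has an eigenvalue of real part `O(δ)`. -/
theorem Matrix.exists_mem_spectrum_re_le {ι : Type*} [Fintype ι] [DecidableEq ι]
    {G K : Matrix ι ι ℂ} (hG : G.PosSemidef) (hK : K.conjTranspose = -K) {ω δ : ℝ}
    (hδ : 0 < δ) {Z : ι → ℂ} (hZ : Z ≠ 0) (hKZ : K.mulVec Z = (Complex.I * ω) • Z)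
    (hGZ : (star Z ⬝ᵥ G.mulVec Z).re ≤ δ * (star Z ⬝ᵥ Z).re) :
    ∃ l ∈ spectrum ℂ (G + K), l.re ≤ 2 * Fintype.card ι * δ := by
  by_contra! hcon
  set a : ℝ := 2 * Fintype.card ι * δ with ha
  have ha0 : 0 ≤ a := by positivity
  -- The shift cancels the frequency of `Z`, leaving `A Z = δ Z + G Z`.
  set s : ℂ := δ - Complex.I * ω with hs
  have hsre : s.re = δ := by simp [hs]
  set A : Matrix ι ι ℂ := algebraMap ℂ _ s + (G + K) with hA
  have hspecA : ∀ x ∈ spectrum ℂ A, a + δ < x.re := by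
    intro x hx
    have h1 : x - s ∈ spectrum ℂ (G + K) := by
      rw [hA, ← spectrum.singleton_add_eq] at hx
      obtain ⟨y, rfl, z, hz, rfl⟩ := hx
      simpa using hz
    have := hcon _ h1
    rw [Complex.sub_re, hsre] at this
    linarith
  have hunit : IsUnit A := by
    rw [← spectrum.zero_notMem_iff ℂ]
    intro h
    have := hspecA 0 h
    simp only [Complex.zero_re] at this
    linarith
  set R : Matrix ι ι ℂ := A⁻¹ with hR
  have hdet : IsUnit A.det := (Matrix.isUnit_iff_isUnit_det A).1 hunit
  have hRA : R * A = 1 := Matrix.nonsing_inv_mul A hdet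
  have hAR : A * R = 1 := Matrix.mul_nonsing_inv A hdet
  have hspecR : ∀ ρ ∈ spectrum ℂ R, ‖ρ‖ ≤ (a + δ)⁻¹ := by
    intro ρ hρ
    let u : (Matrix ι ι ℂ)ˣ := ⟨A, R, hAR, hRA⟩
    have h1 : ρ⁻¹ ∈ spectrum ℂ A := by
      have := (spectrum.inv₀_mem_inv_iff (R := ℂ) (a := u) (r := ρ⁻¹)).1
      simp only [inv_inv] at this
      exact this hρ
    have h2 := (hspecA _ h1).le.trans (Complex.re_le_norm _)
    rw [norm_inv] at h2
    exact le_inv_of_le_inv₀ (by linarith) h2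
  have hup := (Complex.re_le_norm _).trans (R.norm_trace_le_card_mul hspecR)
  have hsum : A + A.conjTranspose = (2 : ℂ) • G + (2 * δ : ℂ) • 1 := by
    have : s + star s = 2 * δ := by
      simp only [hs]; simp; ring
    rw [hA, Matrix.conjTranspose_add, Matrix.conjTranspose_add, hK, hG.1.eq,
      Matrix.algebraMap_eq_diagonal, Matrix.diagonal_conjTranspose, ← this]
    ext i j
    by_cases hij : i = j
    · subst hij; simp; ring
    · simp [hij]; ring
  have hH : (R + R.conjTranspose).PosSemidef := by
    have h1 : R + R.conjTranspose = R.conjTranspose * (A + A.conjTranspose) * R := by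
      rw [mul_add, add_mul, mul_assoc, hAR, ← Matrix.conjTranspose_mul, hAR]
      simp [add_comm]
    rw [h1, hsum]
    refine Matrix.PosSemidef.conjTranspose_mul_mul_same ?_ R
    refine (hG.smul (by norm_num)).add (Matrix.PosSemidef.one.smul ?_)
    exact_mod_cast (by positivity : 0 ≤ 2 * δ)
  have htr := hH.re_dotProduct_mulVec_le_trace Z
  have hAmul : ∀ v, A.mulVec v = s • v + (G.mulVec v + K.mulVec v) := fun v => by
    rw [hA, Matrix.add_mulVec, Matrix.add_mulVec, Algebra.algebraMap_eq_smul_one, Matrix.smul_mulVec,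
      Matrix.one_mulVec]
  set x := R.mulVec (G.mulVec Z) with hx
  have hAx : A.mulVec x = G.mulVec Z := by
    rw [hx, Matrix.mulVec_mulVec, hAR, Matrix.one_mulVec]
  have hZx : Z = (δ : ℂ) • R.mulVec Z + x := by
    have h1 : A.mulVec Z = (δ : ℂ) • Z + G.mulVec Z := by
      rw [hAmul, hKZ, hs, sub_smul]; abel
    calc Z = R.mulVec (A.mulVec Z) := by rw [Matrix.mulVec_mulVec, hRA, Matrix.one_mulVec]
      _ = _ := by rw [h1, Matrix.mulVec_add, Matrix.mulVec_smul]
  have hconj := Matrix.star_dotProduct_mulVec_eq_star (ι := ι)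
  have hKre := Matrix.re_dotProduct_mulVec_eq_zero hK
  have hGre : ∀ v, 0 ≤ (star v ⬝ᵥ G.mulVec v).re := fun v => hG.re_dotProduct_nonneg v
  have hsq : ∀ v : ι → ℂ, star v ⬝ᵥ v = ((star v ⬝ᵥ v).re : ℂ) ∧ 0 ≤ (star v ⬝ᵥ v).re := by
    intro v
    have := dotProduct_star_self_nonneg v
    exact ⟨(Complex.ext (by simp) (by simpa using (Complex.le_def.1 this).2.symm)),
      (Complex.le_def.1 this).1⟩
  -- Pair `A x = G Z` with `x`. With `e2`, the form of `G` at `2x - Z`, this gives `‖x‖ ≤ ‖Z‖/2`,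
  -- and `e3` then gives `Re ⟨Z, x⟩ ≤ ‖Z‖²/2`.
  have e1 : δ * (star x ⬝ᵥ x).re + (star x ⬝ᵥ G.mulVec x).re = (star x ⬝ᵥ G.mulVec Z).re := by
    rw [← hAx, hAmul, dotProduct_add, dotProduct_add, dotProduct_smul, Complex.add_re,
      Complex.add_re, hKre, (hsq x).1, smul_eq_mul, Complex.re_mul_ofReal, hsre]
    simp
  have hGsymm : (star Z ⬝ᵥ G.mulVec x).re = (star x ⬝ᵥ G.mulVec Z).re := by
    rw [hconj, hG.1.eq]; simp
  have e2 : 0 ≤ 4 * (star x ⬝ᵥ G.mulVec x).re - 4 * (star x ⬝ᵥ G.mulVec Z).re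
      + (star Z ⬝ᵥ G.mulVec Z).re := by
    have h := hGre ((2 : ℂ) • x - Z)
    simp only [star_sub, star_smul, sub_dotProduct, Matrix.mulVec_sub, dotProduct_sub,
      Matrix.mulVec_smul, smul_dotProduct, dotProduct_smul, Complex.sub_re] at h
    simp [hGsymm] at h
    linarith
  have hxZ : (star x ⬝ᵥ Z).re = (star Z ⬝ᵥ x).re := by
    have := hconj 1 x Z
    simp only [Matrix.one_mulVec, Matrix.conjTranspose_one] at this
    rw [this]; simp
  have e3 : 0 ≤ (star Z ⬝ᵥ Z).re - 4 * (star Z ⬝ᵥ x).re + 4 * (star x ⬝ᵥ x).re := by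
    have h := (hsq ((2 : ℂ) • x - Z)).2
    simp only [star_sub, star_smul, sub_dotProduct, dotProduct_sub,
      smul_dotProduct, dotProduct_smul, Complex.sub_re] at h
    simp [hxZ] at h
    linarith
  have e4 : (star Z ⬝ᵥ Z).re = δ * (star Z ⬝ᵥ R.mulVec Z).re + (star Z ⬝ᵥ x).re := by
    conv_lhs => rw [congrArg (star Z ⬝ᵥ ·) hZx]
    simp [dotProduct_add]
  have hZpos : 0 < (star Z ⬝ᵥ Z).re := by
    refine lt_of_le_of_ne (hsq Z).2 fun h => hZ ?_
    have h2 := (hsq Z).1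
    rw [← h] at h2
    exact dotProduct_star_self_eq_zero.1 (by simpa using h2)
  have e5 : (star Z ⬝ᵥ (R + R.conjTranspose).mulVec Z).re = 2 * (star Z ⬝ᵥ R.mulVec Z).re := by
    have : (star Z ⬝ᵥ R.conjTranspose.mulVec Z).re = (star Z ⬝ᵥ R.mulVec Z).re := by
      rw [hconj]; simp
    rw [Matrix.add_mulVec, dotProduct_add, Complex.add_re, this]; ring
  have e6 : (R + R.conjTranspose).trace.re = 2 * R.trace.re := by
    rw [Matrix.trace_add, Matrix.trace_conjTranspose]; simp; ring
  rw [e5, e6] at htr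
  have e7 : 1 ≤ 2 * δ * R.trace.re := by
    have h1 : δ * (star x ⬝ᵥ x).re ≤ δ * ((star Z ⬝ᵥ Z).re / 4) := by linarith
    have h2 := le_of_mul_le_mul_left h1 hδ
    have h3 : (star Z ⬝ᵥ Z).re ≤ 2 * δ * R.trace.re * (star Z ⬝ᵥ Z).re := by nlinarith
    exact le_of_mul_le_mul_right (by linarith) hZpos
  have e8 : 2 * δ * R.trace.re ≤ a * (a + δ)⁻¹ := by
    calc 2 * δ * R.trace.re ≤ 2 * δ * (Fintype.card ι * (a + δ)⁻¹) := by gcongr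
      _ = _ := by rw [ha]; ring
  have e9 : a * (a + δ)⁻¹ < 1 := by
    rw [← div_eq_mul_inv, div_lt_one (by linarith)]; linarith
  linarith

/-! ### Eigenvectors of square roots and low eigenvalues -/

/-- The positive semidefinite square root acts on an eigenvector by the square root of the
eigenvalue. -/
theorem sqrt_mulVec_of_mulVec_eq_smul {ι : Type*} [Fintype ι] [DecidableEq ι] {S : Matrix ι ι ℝ}
    (hS : S.PosSemidef) {E : ℝ} (hE : 0 < E) {ψ : ι → ℝ} (h : (S * S).mulVec ψ = E • ψ) :
    S.mulVec ψ = √E • ψ := by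
  -- Since `(S + √E)(S - √E)ψ = 0`, a nonzero `φ` would have the negative eigenvalue `-√E`.
  set φ := S.mulVec ψ - √E • ψ with hφ
  have h1 : S.mulVec φ = -(√E • φ) := by
    rw [hφ, Matrix.mulVec_sub, Matrix.mulVec_mulVec, h, Matrix.mulVec_smul, smul_sub, smul_smul,
      Real.mul_self_sqrt hE.le]
    abel
  have h2 := hS.dotProduct_mulVec_nonneg φ
  rw [h1, dotProduct_neg, dotProduct_smul, smul_eq_mul] at h2
  by_contra hne
  have h3 : 0 < star φ ⬝ᵥ φ := Matrix.dotProduct_star_self_pos_iff.2 (sub_ne_zero.2 hne)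
  have := mul_pos (Real.sqrt_pos.2 hE) h3
  linarith

theorem Matrix.algebraMap_mulVec {ι R : Type*} [Fintype ι] [DecidableEq ι] [CommSemiring R] (a : R)
    (v : ι → R) : (algebraMap R (Matrix ι ι R) a).mulVec v = a • v := by
  rw [Algebra.algebraMap_eq_smul_one, Matrix.smul_mulVec, Matrix.one_mulVec]

/-- A real symmetric matrix has an eigenvalue below each of its diagonal entries. -/
theorem Matrix.IsHermitian.exists_eigenvalue_le_diag {ι : Type*} [Fintype ι] [DecidableEq ι]
    {B : Matrix ι ι ℝ} (hB : B.IsHermitian) (c : ι) :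
    ∃ (E : ℝ) (ψ : ι → ℝ), ψ ≠ 0 ∧ B.mulVec ψ = E • ψ ∧ E ≤ B c c := by
  by_contra! hcon
  have hH : (B - algebraMap ℝ _ (B c c)).IsHermitian :=
    hB.sub (by rw [Matrix.algebraMap_eq_diagonal]; exact Matrix.isHermitian_diagonal _)
  -- Contradictory, as the diagonal entry at `c` vanishes.
  have hpos : (B - algebraMap ℝ _ (B c c)).PosDef := by
    rw [hH.posDef_iff_eigenvalues_pos]
    intro j
    have h1 := hH.mulVec_eigenvectorBasis j
    rw [Matrix.sub_mulVec, algebraMap_mulVec,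
      sub_eq_iff_eq_add, ← add_smul] at h1
    have h2 := hcon _ _ (fun h0 => hH.eigenvectorBasis.orthonormal.ne_zero j
      (WithLp.ofLp_injective 2 h0)) h1
    linarith
  have := hpos.diag_pos (i := c)
  simp [Matrix.algebraMap_eq_diagonal] at this

/-! ### The discrete Schrödinger operator and decay of its eigenvectors -/

theorem isHermitian_schrodinger (d N : ℕ) (η : Site d N → ℝ) : (schrodinger d N η).IsHermitian :=
  (SimpleGraph.posSemidef_lapMatrix ℝ _).1.add (Matrix.isHermitian_diagonal _)

theorem posDef_schrodinger {d N : ℕ} {η : Site d N → ℝ} (hη : ∀ i, 0 < η i) :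
    (schrodinger d N η).PosDef :=
  Matrix.PosDef.posSemidef_add (SimpleGraph.posSemidef_lapMatrix ℝ _) (Matrix.PosDef.diagonal hη)

theorem schrodinger_mulVec_apply {d N : ℕ} (η ψ : Site d N → ℝ) (i : Site d N) :
    (schrodinger d N η).mulVec ψ i = ((latticeGraph d N).degree i + η i) * ψ i
      - ∑ j ∈ (latticeGraph d N).neighborFinset i, ψ j := by
  rw [schrodinger, Matrix.add_mulVec, Pi.add_apply, SimpleGraph.lapMatrix_mulVec_apply,
    Matrix.mulVec_diagonal]
  ring

theorem schrodinger_apply_self {d N : ℕ} (η : Site d N → ℝ) (i : Site d N) :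
    schrodinger d N η i i = (latticeGraph d N).degree i + η i := by
  simp [schrodinger, SimpleGraph.lapMatrix, SimpleGraph.degMatrix]

/-- An integer vector of `ℓ¹`-norm one is a signed unit vector. -/
theorem exists_single_of_sum_abs_eq_one {d : ℕ} {x : Fin d → ℤ} (hx : ∑ k, |x k| = 1) :
    ∃ k, x = Pi.single k 1 ∨ x = Pi.single k (-1) := by
  obtain ⟨k, -, hk⟩ : ∃ k ∈ Finset.univ, |x k| ≠ 0 := by
    by_contra! h
    rw [Finset.sum_eq_zero h] at hx
    exact zero_ne_one hx
  rw [← Finset.add_sum_erase _ _ (Finset.mem_univ k)] at hx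
  have h0 : 0 ≤ ∑ l ∈ Finset.univ.erase k, |x l| := Finset.sum_nonneg fun _ _ => abs_nonneg _
  have h1 : 1 ≤ |x k| := Int.one_le_abs (abs_ne_zero.1 hk)
  have h2 : ∑ l ∈ Finset.univ.erase k, |x l| = 0 := by omega
  have h3 : ∀ l, l ≠ k → x l = 0 := fun l hl => abs_eq_zero.1
    ((Finset.sum_eq_zero_iff_of_nonneg fun _ _ => abs_nonneg _).1 h2 l (by simp [hl]))
  have h4 : ∀ a, x k = a → x = Pi.single k a := by
    rintro a rfl
    ext l
    by_cases hl : l = k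
    · subst hl; simp
    · simp [hl, h3 l hl]
  refine ⟨k, ?_⟩
  rcases eq_or_eq_neg_of_abs_eq (show |x k| = 1 by omega) with h | h
  · exact Or.inl (h4 _ h)
  · exact Or.inr (h4 _ h)

/-- The displacement embeds the neighbours of `i` into the `2d` signed unit vectors. -/
theorem degree_latticeGraph_le (d N : ℕ) (i : Site d N) : (latticeGraph d N).degree i ≤ 2 * d := by
  classical
  let f : Site d N → Fin d → ℤ := fun j k => ((i k : ℕ) : ℤ) - ((j k : ℕ) : ℤ)
  let e : Fin d × Bool → Fin d → ℤ := fun p => Pi.single p.1 (if p.2 then 1 else -1)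
  have hinj : Function.Injective f := by
    intro j j' h
    ext k
    have := congrFun h k
    simp only [f] at this
    omega
  calc (latticeGraph d N).degree i
      = (((latticeGraph d N).neighborFinset i).image f).card :=
        (Finset.card_image_of_injective _ hinj).symm
    _ ≤ (Finset.univ.image e).card := by
        refine Finset.card_le_card fun x hx => ?_
        obtain ⟨j, hj, rfl⟩ := Finset.mem_image.1 hx
        obtain ⟨k, hk | hk⟩ := exists_single_of_sum_abs_eq_one (x := f j)
          ((SimpleGraph.mem_neighborFinset _ _ _).1 hj)
        · exact Finset.mem_image.2 ⟨(k, true), Finset.mem_univ _, by simp [e, hk]⟩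
        · exact Finset.mem_image.2 ⟨(k, false), Finset.mem_univ _, by simp [e, hk]⟩
    _ ≤ Fintype.card (Fin d × Bool) := Finset.card_image_le
    _ = 2 * d := by simp [mul_comm]

/-- The `ℓ¹`-distance on the box. -/
def siteDist {d N : ℕ} (i j : Site d N) : ℤ := ∑ k, |((i k : ℕ) : ℤ) - ((j k : ℕ) : ℤ)|

theorem siteDist_self {d N : ℕ} (i : Site d N) : siteDist i i = 0 := by simp [siteDist]

theorem siteDist_triangle {d N : ℕ} (i j k : Site d N) :
    siteDist i k ≤ siteDist i j + siteDist j k := by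
  rw [siteDist, siteDist, siteDist, ← Finset.sum_add_distrib]
  exact Finset.sum_le_sum fun _ _ => abs_sub_le _ _ _

theorem half_sub_one_le_siteDist_centre {d N : ℕ} (hN : 2 ≤ N) (heven : Even N) {i : Site d N}
    (hi : i ∈ boundary d N) : ((N / 2 - 1 : ℕ) : ℤ) ≤ siteDist i (centre d N hN) := by
  obtain ⟨k, hk⟩ := hi
  obtain ⟨n, rfl⟩ := heven
  refine le_trans ?_ (Finset.single_le_sum (fun _ _ => abs_nonneg _) (Finset.mem_univ k))
  simp only [centre]
  rcases hk with hk | hk <;> rw [hk, le_abs] <;> omega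

/-- Exponential decay of eigenvectors away from a site `c`, when the potential exceeds the energy
by at least `ε` at all other sites. -/
theorem abs_le_of_schrodinger_eigenvector {d N : ℕ} {η ψ : Site d N → ℝ} {E ε M : ℝ}
    (hε : 0 < ε) (h : (schrodinger d N η).mulVec ψ = E • ψ) {c : Site d N}
    (hη : ∀ i, i ≠ c → E + ε ≤ η i) (hM : ∀ i, |ψ i| ≤ M) (k : ℕ) :
    ∀ i, (k : ℤ) ≤ siteDist i c → |ψ i| ≤ M * (2 * d / (2 * d + ε)) ^ k := by
  induction k with
  | zero => simpa using fun i _ => hM i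
  | succ k ih =>
    intro i hi
    set q : ℝ := 2 * d / (2 * d + ε) with hq
    have hM0 : 0 ≤ M := (abs_nonneg _).trans (hM i)
    have hq0 : 0 ≤ q := by positivity
    have hic : i ≠ c := by
      rintro rfl
      rw [siteDist_self] at hi
      push_cast at hi
      omega
    set D : ℝ := ((latticeGraph d N).degree i : ℝ) with hD
    have hD0 : 0 ≤ D := Nat.cast_nonneg _
    have hD2 : D ≤ 2 * d := by rw [hD]; exact_mod_cast degree_latticeGraph_le d N i
    have heq := congrFun h i
    rw [schrodinger_mulVec_apply, Pi.smul_apply, smul_eq_mul] at heq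
    have hsum : (D + η i - E) * ψ i = ∑ j ∈ (latticeGraph d N).neighborFinset i, ψ j := by
      linarith
    have hbound : |∑ j ∈ (latticeGraph d N).neighborFinset i, ψ j| ≤ D * (M * q ^ k) := by
      refine (Finset.abs_sum_le_sum_abs _ _).trans ?_
      rw [hD, ← SimpleGraph.card_neighborFinset_eq_degree, ← nsmul_eq_mul]
      refine Finset.sum_le_card_nsmul _ _ _ fun j hj => ih j ?_
      have h1 : siteDist i j = 1 := (SimpleGraph.mem_neighborFinset _ _ _).1 hj
      have h2 := siteDist_triangle i j c
      push_cast at hi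
      omega
    rw [← hsum, abs_mul, abs_of_pos (by linarith [hη i hic])] at hbound
    have h3 : (D + ε) * |ψ i| ≤ D * (M * q ^ k) :=
      le_trans (mul_le_mul_of_nonneg_right (by linarith [hη i hic]) (abs_nonneg _)) hbound
    -- `t / (t + ε)` increases in `t`, so `2d` neighbours are the worst case.
    have h4 : D / (D + ε) ≤ q := by
      rw [hq, div_le_div_iff₀ (by linarith) (by linarith)]
      nlinarith
    calc |ψ i| ≤ D / (D + ε) * (M * q ^ k) := by
          rw [div_mul_eq_mul_div, le_div_iff₀ (by linarith)]; linarith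
      _ ≤ q * (M * q ^ k) := by gcongr
      _ = M * q ^ (k + 1) := by ring

/-! ### The drift matrix and its normal modes -/

/-- The dissipative part of the complexified drift matrix. -/
def dampingPart {d N : ℕ} (I : Finset (Site d N)) (γ : Site d N → ℝ) :
    Matrix (Site d N ⊕ Site d N) (Site d N ⊕ Site d N) ℂ :=
  Matrix.diagonal (Sum.elim (fun i => ((if i ∈ I then γ i else 0 : ℝ) : ℂ)) 0)

/-- The skew-Hermitian block matrix attached to a real matrix `S`. -/
def skewPart {ι : Type*} (S : Matrix ι ι ℝ) : Matrix (ι ⊕ ι) (ι ⊕ ι) ℂ :=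
  Matrix.fromBlocks 0 (-S.map Complex.ofReal) (S.map Complex.ofReal) 0

open scoped MatrixOrder in
theorem driftMatrix_map_eq {d N : ℕ} (m : ℝ) (η : Site d N → ℝ) (I : Finset (Site d N))
    (γ : Site d N → ℝ) : (driftMatrix m η I γ).map (algebraMap ℝ ℂ) =
      dampingPart I γ + skewPart ((√m)⁻¹ • CFC.sqrt (schrodinger d N η)) := by
  ext (i | i) (j | j)
  · by_cases hij : i = j <;>
      simp [driftMatrix, dampingPart, skewPart, frictionMatrix, hij]
  · simp [driftMatrix, dampingPart, skewPart]
  · simp [driftMatrix, dampingPart, skewPart]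
  · by_cases hij : i = j <;> simp [driftMatrix, dampingPart, skewPart, hij]

open scoped ComplexOrder in
theorem posSemidef_dampingPart {d N : ℕ} {I : Finset (Site d N)} {γ : Site d N → ℝ}
    (hγ : ∀ i ∈ I, 0 < γ i) : (dampingPart I γ).PosSemidef := by
  refine Matrix.PosSemidef.diagonal ?_
  rintro (i | i)
  · by_cases hi : i ∈ I
    · simpa [hi] using (hγ i hi).le
    · simp [hi]
  · simp

theorem conjTranspose_skewPart {ι : Type*} {S : Matrix ι ι ℝ} (hS : S.IsHermitian) :
    (skewPart S).conjTranspose = -skewPart S := by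
  have h : (S.map Complex.ofReal).conjTranspose = S.map Complex.ofReal := by
    ext i j
    simpa using hS.apply i j
  simp [skewPart, Matrix.fromBlocks_conjTranspose, Matrix.fromBlocks_neg, h]

/-- The normal mode `(ψ, -iψ)` built on a real vector `ψ`. -/
noncomputable def normalMode {ι : Type*} (ψ : ι → ℝ) : ι ⊕ ι → ℂ :=
  Sum.elim (fun i => (ψ i : ℂ)) fun i => -Complex.I * ψ i

theorem skewPart_mulVec_normalMode {ι : Type*} [Fintype ι] {S : Matrix ι ι ℝ} {ψ : ι → ℝ} {ω : ℝ}
    (h : S.mulVec ψ = ω • ψ) :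
    (skewPart S).mulVec (normalMode ψ) = (Complex.I * ω) • normalMode ψ := by
  have h1 : ∀ i, ∑ j, (S i j : ℂ) * ψ j = ω * ψ i := fun i => by
    have := congrArg Complex.ofReal (congrFun h i)
    simpa [Matrix.mulVec, dotProduct] using this
  have h2 : (S.map Complex.ofReal).mulVec (fun i => (ψ i : ℂ)) = (ω : ℂ) • fun i => (ψ i : ℂ) := by
    ext i
    simpa [Matrix.mulVec, dotProduct] using h1 i
  have h3 : (fun i => -Complex.I * (ψ i : ℂ)) = (-Complex.I) • fun i => (ψ i : ℂ) := rfl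
  rw [skewPart, normalMode, Matrix.fromBlocks_mulVec]
  ext (i | i)
  · simp only [Sum.elim_comp_inl, Sum.elim_comp_inr, h3, Matrix.neg_mulVec, Matrix.mulVec_smul, h2]
    simp; ring
  · simp only [Sum.elim_comp_inl, Sum.elim_comp_inr, h2]
    simp; ring_nf; simp

theorem star_normalMode_dotProduct_self {ι : Type*} [Fintype ι] (ψ : ι → ℝ) :
    (star (normalMode ψ) ⬝ᵥ normalMode ψ).re = 2 * ∑ i, ψ i ^ 2 := by
  simp [normalMode, dotProduct, two_mul, pow_two]

theorem star_normalMode_dotProduct_dampingPart {d N : ℕ} (I : Finset (Site d N))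
    (γ ψ : Site d N → ℝ) :
    (star (normalMode ψ) ⬝ᵥ (dampingPart I γ).mulVec (normalMode ψ)).re
      = ∑ i ∈ I, γ i * ψ i ^ 2 := by
  have h : ∑ i ∈ I, γ i * ψ i ^ 2 = ∑ i, (if i ∈ I then γ i else 0) * ψ i ^ 2 := by simp
  rw [h]
  simp only [normalMode, dampingPart, dotProduct, Matrix.mulVec_diagonal, Fintype.sum_sum_type,
    Complex.add_re, Complex.re_sum]
  simp only [Pi.star_apply, Sum.elim_inl, Sum.elim_inr, RCLike.star_def, Complex.conj_ofReal,
    ← Complex.ofReal_mul, Complex.ofReal_re, Pi.zero_apply, zero_mul, mul_zero, Complex.zero_re,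
    Finset.sum_const_zero, add_zero]
  exact Finset.sum_congr rfl fun i _ => by ring

/-! ### Assembling the exponential bound -/

/-- Explicit bound for the spectral gap. -/
theorem spectralGap_le {d N : ℕ} (hd : 1 ≤ d) {m ε g : ℝ} (hε : 0 < ε) (hg : 0 < g)
    (hN : 2 ≤ N) (heven : Even N) {η : Site d N → ℝ} {I : Finset (Site d N)} {γ : Site d N → ℝ}
    (hη : ∀ i, 0 < η i) (hc : ∀ i, i ≠ centre d N hN → η (centre d N hN) + 2 * d + ε ≤ η i)
    (hI : ∀ i ∈ I, i ∈ boundary d N) (hγ : ∀ i ∈ I, 0 < γ i ∧ γ i ≤ g) :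
    0 ≤ spectralGap m η I γ ∧
      spectralGap m η I γ ≤ 4 * g * ((N : ℝ) ^ d) ^ 2 * (2 * d / (2 * d + ε)) ^ (N - 2) := by
  set q : ℝ := 2 * d / (2 * d + ε) with hq
  have hd0 : (0 : ℝ) < d := by exact_mod_cast hd
  have hq0 : 0 < q := by positivity
  have hN0 : (0 : ℝ) < N := by exact_mod_cast (by omega : 0 < N)
  have hcard : (Fintype.card (Site d N) : ℝ) = (N : ℝ) ^ d := by simp [Site]
  open scoped MatrixOrder in
  set S := CFC.sqrt (schrodinger d N η) with hSdef
  have hB := posDef_schrodinger hη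
  open scoped MatrixOrder in
  have hS : S.PosSemidef := Matrix.nonneg_iff_posSemidef.1 (CFC.sqrt_nonneg _)
  open scoped MatrixOrder in
  have hSS : S * S = schrodinger d N η :=
    CFC.sqrt_mul_sqrt_self (schrodinger d N η) hB.posSemidef.nonneg
  have hmap : (driftMatrix m η I γ).map (algebraMap ℝ ℂ)
      = dampingPart I γ + skewPart ((√m)⁻¹ • S) := driftMatrix_map_eq m η I γ
  have hG := posSemidef_dampingPart fun i hi => (hγ i hi).1
  have hK : (skewPart ((√m)⁻¹ • S)).conjTranspose = -skewPart ((√m)⁻¹ • S) :=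
    conjTranspose_skewPart (hS.smul (inv_nonneg.2 (Real.sqrt_nonneg m))).1
  have hre : ∀ x ∈ Complex.re '' spectrum ℂ ((driftMatrix m η I γ).map (algebraMap ℝ ℂ)),
      0 ≤ x := by
    rintro _ ⟨l, hl, rfl⟩
    rw [hmap] at hl
    exact Matrix.re_nonneg_of_mem_spectrum hG hK hl
  refine ⟨Real.sInf_nonneg hre, ?_⟩
  obtain ⟨E, ψ, hψ, hEψ, hE⟩ :=
    (isHermitian_schrodinger d N η).exists_eigenvalue_le_diag (centre d N hN)
  have hE2 : E ≤ η (centre d N hN) + 2 * d := by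
    rw [schrodinger_apply_self] at hE
    have : ((latticeGraph d N).degree (centre d N hN) : ℝ) ≤ 2 * d := by
      exact_mod_cast degree_latticeGraph_le d N _
    linarith
  have hE0 : 0 < E := by
    have h1 := hB.dotProduct_mulVec_pos hψ
    rw [hEψ, dotProduct_smul, smul_eq_mul] at h1
    exact pos_of_mul_pos_left h1 (Matrix.dotProduct_star_self_pos_iff.2 hψ).le
  obtain ⟨i₀, hi₀⟩ : ∃ i₀, ∀ i, |ψ i| ≤ |ψ i₀| :=
    haveI : Nonempty (Site d N) := ⟨centre d N hN⟩
    Finite.exists_max fun i => |ψ i|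
  have hdecay := abs_le_of_schrodinger_eigenvector hε hEψ (c := centre d N hN)
    (fun i hi => by linarith [hc i hi]) hi₀ (N / 2 - 1)
  -- At most `N ^ d` damped sites, each with friction at most `g` and `ψ i ^ 2` at most `q ^ (2 * (N
  -- / 2 - 1))` times the maximum.
  set δ : ℝ := g * (N : ℝ) ^ d * q ^ (N - 2) with hδ
  have hδ0 : 0 < δ := by positivity
  have hZ : normalMode ψ ≠ 0 := by
    intro h
    refine hψ (funext fun i => ?_)
    simpa [normalMode] using congrFun h (Sum.inl i)
  have hmode := skewPart_mulVec_normalMode (S := (√m)⁻¹ • S) (ψ := ψ) (ω := (√m)⁻¹ * √E) (by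
    rw [Matrix.smul_mulVec, sqrt_mulVec_of_mulVec_eq_smul hS hE0 (by rw [hSS, hEψ]), smul_smul])
  have hkappa : ∑ i ∈ I, γ i * ψ i ^ 2 ≤ δ * (2 * ∑ i, ψ i ^ 2) := by
    have h1 : ∀ i ∈ I, γ i * ψ i ^ 2 ≤ g * (ψ i₀ ^ 2 * q ^ (N - 2)) := by
      intro i hi
      have h2 := hdecay i (half_sub_one_le_siteDist_centre hN heven (hI i hi))
      have h3 : ψ i ^ 2 ≤ ψ i₀ ^ 2 * q ^ (N - 2) := by
        have h4 : N - 2 = (N / 2 - 1) * 2 := by obtain ⟨n, rfl⟩ := heven; omega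
        rw [h4, pow_mul, ← sq_abs, ← sq_abs (ψ i₀), ← mul_pow]
        gcongr
      exact mul_le_mul (hγ i hi).2 h3 (sq_nonneg _) hg.le
    have h5 : ψ i₀ ^ 2 ≤ ∑ i, ψ i ^ 2 :=
      Finset.single_le_sum (f := fun i => ψ i ^ 2) (fun _ _ => sq_nonneg _) (Finset.mem_univ i₀)
    calc ∑ i ∈ I, γ i * ψ i ^ 2 ≤ I.card * (g * (ψ i₀ ^ 2 * q ^ (N - 2))) := by
          simpa [nsmul_eq_mul] using Finset.sum_le_card_nsmul _ _ _ h1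
      _ ≤ (N : ℝ) ^ d * (g * (ψ i₀ ^ 2 * q ^ (N - 2))) := by
          rw [← hcard]
          gcongr
          exact Finset.card_le_univ I
      _ = δ * ψ i₀ ^ 2 := by rw [hδ]; ring
      _ ≤ δ * (2 * ∑ i, ψ i ^ 2) := by
          have := sq_nonneg (ψ i₀)
          gcongr
          linarith
  obtain ⟨l, hl, hlre⟩ := Matrix.exists_mem_spectrum_re_le hG hK hδ0 hZ hmode (by
    rwa [star_normalMode_dotProduct_self, star_normalMode_dotProduct_dampingPart])
  have hle : spectralGap m η I γ ≤ l.re :=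
    csInf_le ⟨0, hre⟩ ⟨l, by rwa [hmap], rfl⟩
  refine hle.trans (hlre.trans_eq ?_)
  -- Phase space has dimension `2 * N ^ d`, whence the factor 4 and the second `N ^ d`.
  rw [Fintype.card_sum, Nat.cast_add, hcard, hδ]
  ring

/-- A polynomial times a decaying geometric sequence decays exponentially. -/
theorem exists_pow_mul_pow_le_exp (k : ℕ) {q : ℝ} (hq0 : 0 < q) (hq1 : q < 1) :
    ∃ C c : ℝ, 0 < C ∧ 0 < c ∧ ∀ N : ℕ, (N : ℝ) ^ k * q ^ N ≤ C * Real.exp (-(c * N)) := by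
  -- Of `q = √q * √q`, one factor absorbs the polynomial and the other gives the rate.
  have hr0 : 0 < √q := Real.sqrt_pos.2 hq0
  have hr1 : √q < 1 := by rw [Real.sqrt_lt' one_pos]; simpa using hq1
  obtain ⟨C, hC⟩ := (tendsto_pow_const_mul_const_pow_of_abs_lt_one k
    (r := √q) (by rwa [abs_of_pos hr0])).bddAbove_range
  refine ⟨max C 1, -Real.log (√q), by positivity, by linarith [Real.log_neg hr0 hr1], fun N => ?_⟩
  have h1 : (N : ℝ) ^ k * √q ^ N ≤ max C 1 := (hC ⟨N, rfl⟩).trans (le_max_left _ _)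
  have h2 : Real.exp (-(-Real.log (√q) * N)) = √q ^ N := by
    rw [neg_mul, neg_neg, mul_comm, Real.exp_nat_mul, Real.exp_log hr0]
  calc (N : ℝ) ^ k * q ^ N = (N : ℝ) ^ k * √q ^ N * √q ^ N := by
        rw [mul_assoc, ← mul_pow, Real.mul_self_sqrt hq0.le]
    _ ≤ max C 1 * √q ^ N := by gcongr
    _ = _ := by rw [h2]

theorem mainTheorem3 (d : ℕ) (hd : 1 ≤ d) (m ε g : ℝ) (hm : 0 < m) (hε : 0 < ε) :
    ∃ C c : ℝ, 0 < C ∧ 0 < c ∧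
      ∀ (N : ℕ) (hN : 2 ≤ N), Even N →
      ∀ (η : Site d N → ℝ) (I : Finset (Site d N)) (γ : Site d N → ℝ),
        (∀ i, 0 < η i) →
        (∀ i, i ≠ centre d N hN → η (centre d N hN) + 2 * d + ε ≤ η i) →
        I.Nonempty →
        (∀ i ∈ I, i ∈ boundary d N) →
        (∀ i ∈ I, 0 < γ i ∧ γ i ≤ g) →
        0 ≤ spectralGap m η I γ ∧ spectralGap m η I γ ≤ C * Real.exp (-(c * N)) := by
  have hd0 : (0 : ℝ) < d := by exact_mod_cast hd
  set q : ℝ := 2 * d / (2 * d + ε) with hq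
  have hq0 : 0 < q := by positivity
  have hq1 : q < 1 := by rw [hq, div_lt_one (by positivity)]; linarith
  obtain ⟨C, c, hC, hc, h⟩ := exists_pow_mul_pow_le_exp (d * 2) hq0 hq1
  -- `|g| + 1` is a positive friction bound for any sign of `g`; `(q ^ 2)⁻¹` turns `q ^ (N - 2)`
  -- into `q ^ N`.
  refine ⟨4 * (|g| + 1) * (q ^ 2)⁻¹ * C, c, by positivity, hc, ?_⟩
  intro N hN heven η I γ hη hcentre _ hI hγ
  have hgap := spectralGap_le (m := m) hd hε (g := |g| + 1) (by positivity) hN heven hη hcentre hI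
    fun i hi => ⟨(hγ i hi).1, (hγ i hi).2.trans (by linarith [le_abs_self g])⟩
  refine ⟨hgap.1, hgap.2.trans ?_⟩
  rw [← hq]
  have hpow : q ^ (N - 2) = (q ^ 2)⁻¹ * q ^ N := by
    rw [pow_sub₀ q hq0.ne' hN, mul_comm]
  calc 4 * (|g| + 1) * ((N : ℝ) ^ d) ^ 2 * q ^ (N - 2)
      = 4 * (|g| + 1) * (q ^ 2)⁻¹ * ((N : ℝ) ^ (d * 2) * q ^ N) := by rw [hpow, pow_mul]; ring
    _ ≤ 4 * (|g| + 1) * (q ^ 2)⁻¹ * (C * Real.exp (-(c * N))) := 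
        mul_le_mul_of_nonneg_left (h N) (by positivity)
    _ = _ := by ring
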